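/- Let $V$ be a vector space of finite dimension $d>1$ over a field $K$, let $\mathrm{SL}(V)\le G\le \mathrm{GL}(V)$, and let $\Phi$ be a (possibly trivial) group of automorphisms of $K$, acting on $V$ coordinatewise with respect to a fixed basis $b_1,\dots,b_d$, by $\sum_i a_ib_i\mapsto\sum_i\varphi(a_i)b_i$. Let $G\cdot\Phi$ be the group of permutations of $V\setminus\{0\}$ generated by $G$ and $\Phi$ (this is the set of products $g\varphi$ whenever that set is a group). Suppose that $G\cdot\Phi$ is join-coherent on $V\setminus\{0\}$: that is, writing $\pi(x)$ for the partition of $V\setminus\{0\}$ into the orbits of $\langle x\rangle$, for all $x,y\in G\cdot\Phi$ there is $z\in G\cdot\Phi$ such that $\pi(z)=\pi(x)\vee\pi(y)$, the join being taken in the lattice of all partitions of $V\setminus\{0\}$ ordered by refinement. Then $K\cong\mathbf F_2$ and $d=2$. -/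

import Mathlib

/-- The partition `π(g)` of `Ω` into the orbits of `g`. As in Mathlib, partitions are encoded as
equivalence relations, and `≤` on `Setoid Ω` is refinement. -/
def orbitPartition {G : Type*} [Group G] (Ω : Type*) [MulAction G Ω] (g : G) : Setoid Ω :=
  MulAction.orbitRel (Subgroup.zpowers g) Ω

/-- `G` is join-coherent on `Ω` if `π(G) = {π(g) | g ∈ G}` is closed under joins in the lattice
of all partitions of `Ω`. -/
def IsJoinCoherent (G : Type*) [Group G] (Ω : Type*) [MulAction G Ω] : Prop :=
  SupClosed (Set.range (orbitPartition (G := G) Ω))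

section LinearGroups

variable {K V : Type*} [Field K] [AddCommGroup V] [Module K V]

/-- The permutation of the nonzero vectors induced by an additive automorphism. -/
def permNonzero (e : V ≃+ V) : Equiv.Perm {v : V // v ≠ 0} :=
  e.toEquiv.subtypeEquiv fun _ => (not_congr (map_eq_zero_iff e e.injective)).symm

@[simp] theorem coe_permNonzero (e : V ≃+ V) (v : {v : V // v ≠ 0}) :
    (permNonzero e v : V) = e v := rfl

variable (K V) in
/-- The action of `GL(V)` on the nonzero vectors of `V`. -/
def linearPerm : (V ≃ₗ[K] V) →* Equiv.Perm {v : V // v ≠ 0} where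
  toFun g := permNonzero g.toAddEquiv
  map_one' := rfl
  map_mul' _ _ := rfl

/-- The additive bijection of `V` applying the field automorphism `φ` to the coordinates with
respect to the basis `b`, i.e. `∑ aᵢ bᵢ ↦ ∑ φ(aᵢ) bᵢ`. -/
noncomputable def coordAut {ι : Type*} (b : Module.Basis ι K V) (φ : RingAut K) : V ≃+ V :=
  (b.repr.toAddEquiv.trans (Finsupp.mapRange.addEquiv φ.toAddEquiv)).trans b.repr.symm.toAddEquiv

theorem repr_coordAut {ι : Type*} (b : Module.Basis ι K V) (φ : RingAut K) (v : V) (i : ι) :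
    b.repr (coordAut b φ v) i = φ (b.repr v i) := by
  simp [coordAut]

/-- The action of field automorphisms on the nonzero vectors of `V`, through coordinates with
respect to the basis `b`. -/
noncomputable def fieldAutPerm {ι : Type*} (b : Module.Basis ι K V) :
    RingAut K →* Equiv.Perm {v : V // v ≠ 0} where
  toFun φ := permNonzero (coordAut b φ)
  map_one' := by
    ext v
    apply b.repr.injective
    ext i
    simp [repr_coordAut]
  map_mul' φ ψ := by
    ext v
    apply b.repr.injective
    ext i
    simp [repr_coordAut]

/-- The group `G·Φ` of permutations of the nonzero vectors of `V`: the group generated by the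
actions of `G` and `Φ`. It is the set of products `gφ` whenever those form a group. -/
noncomputable def extendedLinearGroup {ι : Type*} (b : Module.Basis ι K V)
    (G : Subgroup (V ≃ₗ[K] V)) (Φ : Subgroup (RingAut K)) :
    Subgroup (Equiv.Perm {v : V // v ≠ 0}) :=
  G.map (linearPerm K V) ⊔ Φ.map (fieldAutPerm b)

end LinearGroups

/-! Everything comes from comparing the orbits of a join `z` with those of two generators. Two
transvections with a common axis force the `z`-orbit of a vector off the axis to be an arithmetic
progression, so both displacements are integer multiples of one vector. Independent displacements
exclude dimension at least 3; proportional ones make every scalar a quotient of integers. Hence `K`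
is a prime field, `Φ` is trivial and `d = 2`. In the plane, take `z` joining two opposite
transvections. Joining two dilations of determinant `det z` shows `det z = 1`, so the quadratic form
`v ↦ ω(v, z v)`, with `ω` the determinant form, is constant on `z`-orbits. The parallelogram law
then forces `2 = 0`, so `K` is the field of two elements. -/

section Joins

variable (R : Type*) {V : Type*} [Ring R] [AddCommGroup V] [Module R V]

variable (V) in
/-- The action of the `R`-linear automorphisms of `V` on the nonzero vectors. -/
def nonzeroPermHom : (V ≃ₗ[R] V) →* Equiv.Perm {v : V // v ≠ 0} where
  toFun g := permNonzero g.toAddEquiv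
  map_one' := rfl
  map_mul' _ _ := rfl

@[simp] theorem coe_nonzeroPermHom (e : V ≃ₗ[R] V) (v : {v : V // v ≠ 0}) :
    (nonzeroPermHom R V e v : V) = e v := rfl

theorem coe_zpow_smul_nonzero {Γ : Subgroup (Equiv.Perm {v : V // v ≠ 0})} {z : V ≃ₗ[R] V}
    (hz : nonzeroPermHom R V z ∈ Γ) (k : ℤ) (v : {v : V // v ≠ 0}) :
    (((⟨_, hz⟩ : Γ) ^ k • v : {v : V // v ≠ 0}) : V) = (z ^ k) v := by
  change ((((⟨_, hz⟩ : Γ) ^ k : Γ) : Equiv.Perm {v : V // v ≠ 0}) v : V) = _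
  rw [Subgroup.coe_zpow, ← map_zpow, coe_nonzeroPermHom]

/-- In a join-coherent group of linear permutations, the join of `π(x)` and `π(y)` is `π(z)`
for some linear `z`. -/
theorem exists_orbitPartition_join {Γ : Subgroup (Equiv.Perm {v : V // v ≠ 0})}
    (hΓ : Γ ≤ (nonzeroPermHom R V).range) (h : IsJoinCoherent Γ {v : V // v ≠ 0})
    {x y : V ≃ₗ[R] V} (hx : nonzeroPermHom R V x ∈ Γ) (hy : nonzeroPermHom R V y ∈ Γ) :
    ∃ z : V ≃ₗ[R] V, nonzeroPermHom R V z ∈ Γ ∧ (∀ v, ∃ k : ℤ, (z ^ k) v = x v) ∧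
      (∀ v, ∃ k : ℤ, (z ^ k) v = y v) ∧
      ∀ r : Setoid V, (∀ v, r v (x v)) → (∀ v, r v (y v)) → ∀ v, r v (z v) := by
  obtain ⟨⟨_, hz⟩, hzz⟩ := h ⟨⟨_, hx⟩, rfl⟩ ⟨⟨_, hy⟩, rfl⟩
  obtain ⟨z, rfl⟩ := hΓ hz
  have self : ∀ (g : Γ) (v : {v : V // v ≠ 0}), orbitPartition {v : V // v ≠ 0} g (g • v) v :=
    fun g v => ⟨⟨g, Subgroup.mem_zpowers g⟩, rfl⟩
  have orb : ∀ u : V ≃ₗ[R] V, ∀ hu : nonzeroPermHom R V u ∈ Γ,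
      orbitPartition {v : V // v ≠ 0} (⟨_, hu⟩ : Γ) ≤
        orbitPartition {v : V // v ≠ 0} (⟨_, hz⟩ : Γ) → ∀ v, ∃ k : ℤ, (z ^ k) v = u v := by
    intro u hu hle v
    by_cases hv : v = 0
    · exact ⟨0, by simp [hv]⟩
    obtain ⟨⟨_, k, rfl⟩, hk⟩ := hle (self ⟨_, hu⟩ ⟨v, hv⟩)
    refine ⟨k, ?_⟩
    exact (coe_zpow_smul_nonzero R hz k ⟨v, hv⟩).symm.trans (congrArg Subtype.val hk)
  refine ⟨z, hz, orb x hx (hzz ▸ le_sup_left), orb y hy (hzz ▸ le_sup_right), ?_⟩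
  intro r hrx hry v
  by_cases hv : v = 0
  · simp [hv]
  have key : ∀ u : V ≃ₗ[R] V, ∀ hu : nonzeroPermHom R V u ∈ Γ, (∀ v, r v (u v)) →
      orbitPartition {v : V // v ≠ 0} (⟨_, hu⟩ : Γ) ≤ r.comap Subtype.val := by
    rintro u hu hr a c ⟨⟨_, k, rfl⟩, rfl⟩
    have hpow : ∀ k : ℤ, ∀ v, r v ((u ^ k) v) := by
      intro k
      induction k with
      | zero => exact fun v => by simp
      | succ k ih =>
        intro v
        rw [zpow_add_one]
        exact r.trans (hr v) (ih (u v))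
      | pred k ih =>
        intro v
        rw [zpow_sub_one]
        refine r.trans (r.symm ?_) (ih (u⁻¹ v))
        simpa using hr (u⁻¹ v)
    have hc := r.symm (hpow k c.1)
    rwa [← coe_zpow_smul_nonzero R hu] at hc
  have hle : orbitPartition {v : V // v ≠ 0} (⟨_, hz⟩ : Γ) ≤ r.comap Subtype.val := by
    rw [hzz]
    exact sup_le (key x hx hrx) (key y hy hry)
  exact r.symm (hle (self ⟨_, hz⟩ ⟨v, hv⟩))

end Joins

/-! ### Transvections with a common axis; reduction to prime fields -/

section Transvections

variable {K V : Type*} [Field K] [AddCommGroup V] [Module K V]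

theorem range_linearPerm_le : (linearPerm K V).range ≤ (nonzeroPermHom ℤ V).range := by
  rintro _ ⟨g, rfl⟩
  exact ⟨g.restrictScalars ℤ, rfl⟩

/-- Field automorphisms are only additive on `V`, so joins are first studied among `ℤ`-linear maps.
-/
theorem extendedLinearGroup_le {ι : Type*} (b : Module.Basis ι K V)
    (G : Subgroup (V ≃ₗ[K] V)) (Φ : Subgroup (RingAut K)) :
    extendedLinearGroup b G Φ ≤ (nonzeroPermHom ℤ V).range := by
  refine sup_le ((Subgroup.map_le_range _ _).trans range_linearPerm_le) ?_
  rintro _ ⟨φ, -, rfl⟩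
  exact ⟨(coordAut b φ).toIntLinearEquiv, rfl⟩

/-- If two transvections have a common axis, the join of their orbit partitions is the orbit
partition of an additive map only if their displacements lie in a common cyclic group. -/
theorem exists_zsmul_of_transvection [FiniteDimensional K V]
    {Γ : Subgroup (Equiv.Perm {v : V // v ≠ 0})}
    (hΓ : Γ ≤ (nonzeroPermHom ℤ V).range) (h : IsJoinCoherent Γ {v : V // v ≠ 0})
    (hSL : ∀ g : V ≃ₗ[K] V, LinearEquiv.det g = 1 → linearPerm K V g ∈ Γ)
    (f : Module.Dual K V) {e u₁ u₂ : V} (he : f e = 1) (h₁ : f u₁ = 0) (h₂ : f u₂ = 0) :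
    ∃ (w : V) (m n : ℤ), m • w = u₁ ∧ n • w = u₂ := by
  obtain ⟨z, -, hx, hy, hr⟩ := exists_orbitPartition_join ℤ hΓ h
    (x := (LinearEquiv.transvection h₁).restrictScalars ℤ)
    (y := (LinearEquiv.transvection h₂).restrictScalars ℤ)
    (hSL _ (LinearEquiv.transvection.det_eq_one _)) (hSL _ (LinearEquiv.transvection.det_eq_one _))
  -- Both transvections move `v` within `v + f v • (ℤ u₁ + ℤ u₂)`, hence so does `z`.
  let r : Setoid V :=
    { r := fun v w => f v = f w ∧ ∃ m n : ℤ, w = v + f v • (m • u₁ + n • u₂)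
      iseqv :=
        { refl := fun v => ⟨rfl, 0, 0, by simp⟩
          symm := by
            rintro v w ⟨hf, m, n, hw⟩
            refine ⟨hf.symm, -m, -n, ?_⟩
            rw [← hf, hw]
            module
          trans := by
            rintro u v w ⟨hf, m, n, hw⟩ ⟨hf', m', n', hw'⟩
            refine ⟨hf.trans hf', m + m', n + n', ?_⟩
            rw [hw', ← hf, hw]
            module } }
  have hz : ∀ v, f v = f (z v) ∧ ∃ m n : ℤ, z v = v + f v • (m • u₁ + n • u₂) := by
    refine hr r (fun v => ?_) (fun v => ?_)
    · exact ⟨by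
        change f v = f (v + f v • u₁); simp [h₁], 1, 0,
        by change v + f v • _ = _; simp⟩
    · exact ⟨by
        change f v = f (v + f v • u₂); simp [h₂], 0, 1,
        by change v + f v • _ = _; simp⟩
  obtain ⟨m, n, hw⟩ := (hz e).2
  rw [he, one_smul] at hw
  set w := m • u₁ + n • u₂ with hwdef
  have hzw : z w = w := by
    obtain ⟨m', n', h'⟩ := (hz w).2
    have hfw : f w = 0 := by simp [hwdef, h₁, h₂]
    simpa [hfw] using h'
  -- Since `z` fixes `w`, the `z`-orbit of `e` is `e + ℤ w`; it contains `e + u₁` and `e + u₂`.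
  have hpow : ∀ k : ℤ, (z ^ k) e = e + k • w := by
    intro k
    induction k with
    | zero => simp
    | succ k ih =>
      rw [add_comm, zpow_one_add, LinearEquiv.mul_apply, ih, map_add, map_zsmul, hw, hzw]
      module
    | pred k ih =>
      apply z.injective
      rw [sub_eq_neg_add, zpow_add, LinearEquiv.mul_apply, ← LinearEquiv.mul_apply, zpow_neg_one,
        mul_inv_cancel, LinearEquiv.coe_one, id, ih, map_add, map_zsmul, hw, hzw]
      module
  obtain ⟨k, hk⟩ := hx e
  obtain ⟨l, hl⟩ := hy e
  refine ⟨w, k, l, ?_, ?_⟩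
  · have hk' : e + k • w = e + f e • u₁ := (hpow k).symm.trans hk
    simpa [he] using hk'
  · have hl' : e + l • w = e + f e • u₂ := (hpow l).symm.trans hl
    simpa [he] using hl'

/-- A linear group containing `SL(V)` that is join-coherent has degree at most two. -/
theorem false_of_isJoinCoherent_of_basis {ι : Type*} [FiniteDimensional K V]
    {Γ : Subgroup (Equiv.Perm {v : V // v ≠ 0})}
    (hΓ : Γ ≤ (nonzeroPermHom ℤ V).range) (h : IsJoinCoherent Γ {v : V // v ≠ 0})
    (hSL : ∀ g : V ≃ₗ[K] V, LinearEquiv.det g = 1 → linearPerm K V g ∈ Γ)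
    (b : Module.Basis ι K V) {i j k : ι} (hij : i ≠ j) (hik : i ≠ k) (hjk : j ≠ k) : False := by
  obtain ⟨w, m, n, hm, hn⟩ := exists_zsmul_of_transvection hΓ h hSL (b.coord i)
    (e := b i) (u₁ := b j) (u₂ := b k) (by simp) (by simp [hij.symm]) (by simp [hik.symm])
  have hj := congrArg (b.coord j) hm
  have hk := congrArg (b.coord k) hn
  have hj' := congrArg (b.coord j) hn
  simp [hjk] at hj hk hj'
  rcases hj' with h0 | h0
  · simp [h0] at hk
  · simp [h0] at hj

/-- If a linear group of degree at least two containing `SL(V)` is join-coherent, then every scalar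
is a quotient of two integers. -/
theorem exists_intCast_mul_of_isJoinCoherent {ι : Type*} [FiniteDimensional K V]
    {Γ : Subgroup (Equiv.Perm {v : V // v ≠ 0})}
    (hΓ : Γ ≤ (nonzeroPermHom ℤ V).range) (h : IsJoinCoherent Γ {v : V // v ≠ 0})
    (hSL : ∀ g : V ≃ₗ[K] V, LinearEquiv.det g = 1 → linearPerm K V g ∈ Γ)
    (b : Module.Basis ι K V) {i j : ι} (hij : i ≠ j) (a : K) :
    ∃ (c : K) (m n : ℤ), m * c = 1 ∧ n * c = a := by
  obtain ⟨w, m, n, hm, hn⟩ := exists_zsmul_of_transvection hΓ h hSL (b.coord i)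
    (e := b i) (u₁ := b j) (u₂ := a • b j) (by simp) (by simp [hij.symm]) (by simp [hij.symm])
  refine ⟨b.coord j w, m, n, ?_, ?_⟩
  · simpa using congrArg (b.coord j) hm
  · simpa using congrArg (b.coord j) hn

/-- A field automorphism fixes integers, hence their quotients. -/
theorem ringAut_eq_one_of_intCast_mul (hK : ∀ a : K, ∃ (c : K) (m n : ℤ), m * c = 1 ∧ n * c = a)
    (φ : RingAut K) : φ = 1 := by
  ext a
  obtain ⟨c, m, n, hm, rfl⟩ := hK a
  have hm' : (m : K) * φ c = 1 := by simpa using congrArg φ hm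
  have hc : φ c = c := mul_left_cancel₀ (left_ne_zero_of_mul_eq_one hm) (hm'.trans hm.symm)
  simp [hc]

theorem nonempty_ringEquiv_zmod_two (hK : ∀ a : K, ∃ (c : K) (m n : ℤ), m * c = 1 ∧ n * c = a)
    (h2 : (2 : K) = 0) : Nonempty (K ≃+* ZMod 2) := by
  have : CharP K 2 := CharTwo.of_one_ne_zero_of_two_eq_zero one_ne_zero h2
  have hint : ∀ n : ℤ, (n : K) = 0 ∨ (n : K) = 1 := by
    intro n
    rcases Int.even_or_odd' n with ⟨k, rfl | rfl⟩ <;> simp [h2]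
  refine ⟨(RingEquiv.ofBijective (ZMod.castHom (dvd_refl 2) K)
    ⟨RingHom.injective _, fun a => ?_⟩).symm⟩
  obtain ⟨c, m, n, hm, rfl⟩ := hK a
  have hm1 : (m : K) = 1 := (hint m).resolve_left (left_ne_zero_of_mul_eq_one hm)
  rw [hm1, one_mul] at hm
  exact ⟨n, by simp [hm]⟩

end Transvections

/-! ### The plane: determinant and quadratic form of a join -/

section Plane

variable {K V : Type*} [Field K] [AddCommGroup V] [Module K V]

theorem zpow_apply_of_apply_eq_smul {g : V ≃ₗ[K] V} {e : V} {c : K} (hc : c ≠ 0)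
    (hge : g e = c • e) (k : ℤ) : (g ^ k) e = c ^ k • e := by
  induction k with
  | zero => simp
  | succ k ih =>
    rw [zpow_add_one, LinearEquiv.mul_apply, hge, map_smul, ih, smul_smul, zpow_add_one₀ hc,
      mul_comm]
  | pred k ih =>
    have hge' : g⁻¹ e = c⁻¹ • e := by
      apply g.injective
      rw [map_smul, hge, smul_smul, inv_mul_cancel₀ hc, ← LinearEquiv.mul_apply, mul_inv_cancel]
      simp
    rw [zpow_sub_one, LinearEquiv.mul_apply, hge', map_smul, ih, smul_smul, zpow_sub_one₀ hc,
      mul_comm]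

theorem exists_join_of_map {G : Subgroup (V ≃ₗ[K] V)}
    (h : IsJoinCoherent (G.map (linearPerm K V)) {v : V // v ≠ 0}) {x y : V ≃ₗ[K] V}
    (hx : x ∈ G) (hy : y ∈ G) :
    ∃ z ∈ G, (∀ v, ∃ k : ℤ, (z ^ k) v = x v) ∧ (∀ v, ∃ k : ℤ, (z ^ k) v = y v) ∧
      ∀ r : Setoid V, (∀ v, r v (x v)) → (∀ v, r v (y v)) → ∀ v, r v (z v) := by
  obtain ⟨z, ⟨g, hg, hgz⟩, h1⟩ := exists_orbitPartition_join K (Subgroup.map_le_range _ _) h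
    (x := x) (y := y) ⟨x, hx, rfl⟩ ⟨y, hy, rfl⟩
  obtain rfl : g = z := by
    ext v
    by_cases hv : v = 0
    · simp [hv]
    · exact congrArg Subtype.val (DFunLike.congr_fun hgz ⟨v, hv⟩)
  exact ⟨g, hg, h1⟩

/-- If `G` contains the scalings by `δ` of each of two basis vectors separately, then `δ = 1`. -/
theorem eq_one_of_dilatransvection_mem {G : Subgroup (V ≃ₗ[K] V)}
    (h : IsJoinCoherent (G.map (linearPerm K V)) {v : V // v ≠ 0})
    {f₀ f₁ : Module.Dual K V} {e₀ e₁ : V} (h₀₀ : f₀ e₀ = 1) (h₀₁ : f₀ e₁ = 0) (h₁₀ : f₁ e₀ = 0)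
    (h₁₁ : f₁ e₁ = 1) {δ : K} {s₀ s₁ : V ≃ₗ[K] V} (hs₀ : s₀ ∈ G) (hs₁ : s₁ ∈ G)
    (hs₀' : ∀ v, s₀ v = v + f₀ v • (δ - 1) • e₀) (hs₁' : ∀ v, s₁ v = v + f₁ v • (δ - 1) • e₁) :
    δ = 1 := by
  have hδ : δ ≠ 0 := by
    rintro rfl
    have : s₀ e₀ = 0 := by simp [hs₀', h₀₀]
    rw [LinearEquiv.map_eq_zero_iff] at this
    simp [this] at h₀₀
  obtain ⟨g, hg, hx, hy, hr⟩ := exists_join_of_map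
    h hs₀ hs₁
  -- Both dilations multiply the two coordinates by powers of `δ`, so the join `g` does too and is
  -- diagonal on `e₀`, `e₁`.
  let r : Setoid V :=
    { r := fun v w => ∃ i j : ℤ, f₀ w = δ ^ i * f₀ v ∧ f₁ w = δ ^ j * f₁ v ∧
        w = v + (f₀ w - f₀ v) • e₀ + (f₁ w - f₁ v) • e₁
      iseqv :=
        { refl := fun v => ⟨0, 0, by simp⟩
          symm := by
            rintro v w ⟨i, j, hi, hj, hw⟩
            refine ⟨-i, -j, ?_, ?_, ?_⟩
            · rw [hi, ← mul_assoc, ← zpow_add₀ hδ]; simp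
            · rw [hj, ← mul_assoc, ← zpow_add₀ hδ]; simp
            · calc v = v + (f₀ w - f₀ v) • e₀ + (f₁ w - f₁ v) • e₁ + (f₀ v - f₀ w) • e₀ +
                    (f₁ v - f₁ w) • e₁ := by module
                _ = w + (f₀ v - f₀ w) • e₀ + (f₁ v - f₁ w) • e₁ := by rw [← hw]
          trans := by
            rintro u v w ⟨i, j, hi, hj, hw⟩ ⟨i', j', hi', hj', hw'⟩
            refine ⟨i' + i, j' + j, ?_, ?_, ?_⟩
            · rw [hi', hi, zpow_add₀ hδ, mul_assoc]
            · rw [hj', hj, zpow_add₀ hδ, mul_assoc]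
            · nth_rw 1 [hw']
              nth_rw 1 [hw]
              module } }
  have hz : ∀ v, ∃ i j : ℤ, f₀ (g v) = δ ^ i * f₀ v ∧ f₁ (g v) = δ ^ j * f₁ v ∧
        g v = v + (f₀ (g v) - f₀ v) • e₀ + (f₁ (g v) - f₁ v) • e₁ := by
    refine hr r (fun v => ?_) (fun v => ?_)
    · refine ⟨1, 0, ?_, ?_, ?_⟩ <;> simp [hs₀', h₀₀, h₁₀, smul_smul]
      ring
    · refine ⟨0, 1, ?_, ?_, ?_⟩ <;> simp [hs₁', h₁₁, h₀₁, smul_smul]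
      ring
  obtain ⟨i, -, hi, -, hi'⟩ := hz e₀
  obtain ⟨-, j, -, hj, hj'⟩ := hz e₁
  have hge₀ : g e₀ = δ ^ i • e₀ := by
    obtain ⟨_, j', _, h1, _⟩ := hz e₀
    rw [hi', hi, h1, h₀₀, h₁₀]; module
  have hge₁ : g e₁ = δ ^ j • e₁ := by
    obtain ⟨j', _, h1, _, _⟩ := hz e₁
    rw [hj', hj, h1, h₁₁, h₀₁]; module
  have hpow : ∀ (k i : ℤ) (e : V), g e = δ ^ i • e → (g ^ k) e = δ ^ (i * k) • e :=
    fun k i e hge => by rw [zpow_apply_of_apply_eq_smul (zpow_ne_zero i hδ) hge, zpow_mul]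
  -- The orbit of `e₀ + e₁` must contain `δ e₀ + e₁` and `e₀ + δ e₁`, whereas a single power of `g`
  -- ties the two exponents together.
  obtain ⟨k, hk⟩ := hx (e₀ + e₁)
  obtain ⟨l, hl⟩ := hy (e₀ + e₁)
  rw [map_add, hpow k i e₀ hge₀, hpow k j e₁ hge₁, hs₀'] at hk
  rw [map_add, hpow l i e₀ hge₀, hpow l j e₁ hge₁, hs₁'] at hl
  have hik : δ ^ (i * k) = δ := by simpa [h₀₀, h₀₁] using congrArg f₀ hk
  have hjk : δ ^ (j * k) = 1 := by simpa [h₁₀, h₁₁] using congrArg f₁ hk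
  have hjl : δ ^ (j * l) = δ := by simpa [h₁₀, h₁₁] using congrArg f₁ hl
  calc δ = (δ ^ (i * k)) ^ (j * l) := by rw [hik, hjl]
    _ = (δ ^ (j * k)) ^ (i * l) := by rw [← zpow_mul, ← zpow_mul]; congr 1; ring
    _ = 1 := by rw [hjk, one_zpow]

/-- If `SL(V) ≤ G ≤ GL(V)` is join-coherent in dimension two, then `V` has characteristic two. -/
theorem two_eq_zero_of_isJoinCoherent {G : Subgroup (V ≃ₗ[K] V)}
    (hG : ∀ g : V ≃ₗ[K] V, LinearEquiv.det g = 1 → g ∈ G)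
    (h : IsJoinCoherent (G.map (linearPerm K V)) {v : V // v ≠ 0})
    (b : Module.Basis (Fin 2) K V) : (2 : K) = 0 := by
  have : FiniteDimensional K V := b.finiteDimensional_of_finite
  set f₀ := b.coord 0 with hf₀
  set f₁ := b.coord 1 with hf₁
  set e₀ := b 0 with he₀
  set e₁ := b 1 with he₁
  have h₀₀ : f₀ e₀ = 1 := by simp [hf₀, he₀]
  have h₀₁ : f₀ e₁ = 0 := by simp [hf₀, he₁]
  have h₁₀ : f₁ e₀ = 0 := by simp [hf₁, he₀]
  have h₁₁ : f₁ e₁ = 1 := by simp [hf₁, he₁]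
  obtain ⟨z, hz, hx, hy, -⟩ := exists_join_of_map h
    (hG _ (LinearEquiv.transvection.det_eq_one h₀₁)) (hG _ (LinearEquiv.transvection.det_eq_one h₁₀))
  simp only [LinearEquiv.transvection.apply] at hx hy
  have hdet : LinearEquiv.det z = 1 := by
    -- The dilation by `δ` along one basis vector differs from `z` by a factor in `SL(V)`, so it
    -- lies in `G`.
    set δ : K := LinearMap.det (z : V →ₗ[K] V) with hδ
    have hδu : IsUnit δ := by rw [hδ, ← LinearEquiv.coe_det]; exact Units.isUnit _
    have hmem : ∀ (f : Module.Dual K V) (e : V), f e = 1 →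
        ∃ s ∈ G, ∀ v, s v = v + f v • (δ - 1) • e := by
      intro f e he
      have hu : IsUnit (1 + f ((δ - 1) • e)) := by simpa [he] using hδu
      refine ⟨LinearEquiv.dilatransvection hu, ?_, fun v => LinearEquiv.dilatransvection.apply⟩
      have h1 : LinearEquiv.det (LinearEquiv.dilatransvection hu) = LinearEquiv.det z := by
        rw [← Units.val_inj, LinearEquiv.coe_det, LinearEquiv.coe_det,
          LinearEquiv.dilatransvection.coe_toLinearMap, LinearMap.transvection.det]
        simp [he, hδ]
      have h2 := G.mul_mem (hG (LinearEquiv.dilatransvection hu * z⁻¹) (by simp [h1])) hz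
      simpa using h2
    obtain ⟨s₀, hs₀, hs₀'⟩ := hmem f₀ e₀ h₀₀
    obtain ⟨s₁, hs₁, hs₁'⟩ := hmem f₁ e₁ h₁₁
    rw [← Units.val_inj, LinearEquiv.coe_det]
    exact eq_one_of_dilatransvection_mem h h₀₀ h₀₁ h₁₀ h₁₁ hs₀ hs₁ hs₀' hs₁'
  let O : Set V := {v | ∃ k : ℤ, (z ^ k) e₀ = v}
  have hO : ∀ v w, v ∈ O → (∃ k : ℤ, (z ^ k) v = w) → w ∈ O := by
    rintro _ _ ⟨k, rfl⟩ ⟨l, rfl⟩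
    exact ⟨l + k, by rw [zpow_add, LinearEquiv.mul_apply]⟩
  have hO' : ∀ v w, v ∈ O → (∃ k : ℤ, (z ^ k) w = v) → w ∈ O := by
    rintro v w hv ⟨k, rfl⟩
    exact hO _ _ hv ⟨-k, by rw [← LinearEquiv.mul_apply, ← zpow_add]; simp⟩
  have m₀ : e₀ ∈ O := ⟨0, by simp⟩
  have madd : e₀ + e₁ ∈ O := hO _ _ m₀ (by simpa [h₁₀, h₀₀] using hx e₀)
  have m₁ : e₁ ∈ O := hO' _ _ madd (by simpa [h₁₁, h₀₁, add_comm] using hy e₁)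
  have msub : e₀ - e₁ ∈ O := hO' _ _ m₀ (by simpa [h₁₀, h₀₀, h₀₁] using hx (e₀ - e₁))
  -- As `det z = 1`, `z` preserves `ω`; it commutes with its own powers, so `Q v = ω v (z v)` is
  -- constant on `O`.
  let ω : V → V → K := fun v w => f₀ v * f₁ w - f₁ v * f₀ w
  have hω : ∀ v w, ω v w = b.det ![v, w] := by
    intro v w
    simp [ω, Module.Basis.det_apply, Matrix.det_fin_two, Module.Basis.toMatrix_apply, hf₀, hf₁]
    ring
  have hQ : ∀ v ∈ O, ω v (z v) = ω e₀ (z e₀) := by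
    rintro _ ⟨k, rfl⟩
    have hc : z ((z ^ k) e₀) = (z ^ k) (z e₀) := by
      rw [← LinearEquiv.mul_apply, ← LinearEquiv.mul_apply, ← zpow_one_add, ← zpow_add_one,
        add_comm]
    have hd : LinearMap.det ((z ^ k : V ≃ₗ[K] V) : V →ₗ[K] V) = 1 := by
      rw [← LinearEquiv.coe_det, map_zpow, hdet]; simp
    have hcomp := b.det_comp ((z ^ k : V ≃ₗ[K] V) : V →ₗ[K] V) ![e₀, z e₀]
    rw [hc, hω, hω, ← one_mul (b.det ![e₀, z e₀]), ← hd, ← hcomp]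
    congr 1
    ext i
    fin_cases i <;> simp
  by_contra h2
  have q₁ := hQ _ m₁
  have qa := hQ _ madd
  have qs := hQ _ msub
  simp only [ω, map_add, map_sub, h₀₀, h₀₁, h₁₀, h₁₁] at q₁ qa qs
  -- The value `q = f₁ (z e₀)` of `Q` is shared by `e₀`, `e₁`, `e₀ + e₁`, `e₀ - e₁`, so the
  -- parallelogram law reads `2q = 4q`.
  have hz0 : f₁ (z e₀) = 0 := by
    have : 2 * f₁ (z e₀) = 0 := by linear_combination qa + qs - 2 * q₁
    exact (mul_eq_zero.mp this).resolve_left h2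
  have hze : z e₀ = f₀ (z e₀) • e₀ := by
    have hsum := b.sum_repr (z e₀)
    rw [Fin.sum_univ_two] at hsum
    change f₀ (z e₀) • e₀ + f₁ (z e₀) • e₁ = z e₀ at hsum
    rwa [hz0, zero_smul, add_zero, eq_comm] at hsum
  have hc : f₀ (z e₀) ≠ 0 := by
    intro hc
    rw [hc, zero_smul, LinearEquiv.map_eq_zero_iff] at hze
    simp [hze] at h₀₀
  -- The orbit of the eigenvector `e₀` stays on its line, yet contains `e₁`.
  obtain ⟨k, hk⟩ := m₁
  rw [zpow_apply_of_apply_eq_smul hc hze] at hk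
  simpa [h₁₀, h₁₁] using congrArg f₁ hk

end Plane

theorem mainTheorem7 {K V ι : Type*} [Field K] [AddCommGroup V] [Module K V]
    [FiniteDimensional K V] (hd : 1 < Module.finrank K V) (b : Module.Basis ι K V)
    (Φ : Subgroup (RingAut K)) (G : Subgroup (V ≃ₗ[K] V))
    (hG : (SpecialLinearGroup.toLinearEquiv : SpecialLinearGroup K V →* (V ≃ₗ[K] V)).range ≤ G)
    (h : IsJoinCoherent (extendedLinearGroup b G Φ) {v : V // v ≠ 0}) :
    Nonempty (K ≃+* ZMod 2) ∧ Module.finrank K V = 2 := by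
  have hG' : ∀ g : V ≃ₗ[K] V, LinearEquiv.det g = 1 → g ∈ G := fun g hg => hG ⟨⟨g, hg⟩, rfl⟩
  have hSL : ∀ g : V ≃ₗ[K] V, LinearEquiv.det g = 1 →
      linearPerm K V g ∈ extendedLinearGroup b G Φ := fun g hg =>
    (le_sup_left : G.map (linearPerm K V) ≤ _) ⟨g, hG' g hg, rfl⟩
  have hΓ := extendedLinearGroup_le b G Φ
  let c := Module.finBasis K V
  have hfin : Module.finrank K V = 2 := by
    by_contra hne
    refine false_of_isJoinCoherent_of_basis hΓ h hSL c
      (i := ⟨0, by omega⟩) (j := ⟨1, by omega⟩) (k := ⟨2, by omega⟩) ?_ ?_ ?_ <;> simp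
  let c₂ : Module.Basis (Fin 2) K V := c.reindex (finCongr hfin)
  have hK := exists_intCast_mul_of_isJoinCoherent hΓ h hSL c₂ (zero_ne_one : (0 : Fin 2) ≠ 1)
  -- With `Φ` acting trivially, joins can be taken in `G` itself, where determinants are available.
  have hΦ : extendedLinearGroup b G Φ = G.map (linearPerm K V) := by
    refine sup_eq_left.mpr ?_
    rintro _ ⟨φ, -, rfl⟩
    rw [ringAut_eq_one_of_intCast_mul hK φ, map_one]
    exact one_mem _
  rw [hΦ] at h
  exact ⟨nonempty_ringEquiv_zmod_two hK (two_eq_zero_of_isJoinCoherent hG' h c₂), hfin⟩
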